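/- Let $L$ be a (possibly many-sorted) first-order language, $|T|$ the number of $L$-formulas (the number of symbols, sorts included, plus $\aleph_0$), and $\mathfrak C$ a monster model of a complete $L$-theory $T$: $\mathfrak C$ is $\kappa$-saturated and strongly $\kappa$-homogeneous for a strong limit cardinal $\kappa>|T|$. A cardinal is *bounded* if it is less than $\kappa$. Let $S$ be a product of $l_S$ sorts of $L$ (repetitions allowed, $l_S$ arbitrary), with variables $\bar x$, let $X$ be a $\emptyset$-type-definable subset of $S$, i.e. a partial type over $\emptyset$ in the variables $\bar x$, and let $S_X(\mathfrak C)$ be the space of complete types over $\mathfrak C$ in the variables $\bar x$ that contain $X$, with its natural action of $\mathrm{Aut}(\mathfrak C)$. Let $EL(S_X(\mathfrak C))$ be its Ellis semigroup, i.e. the closure of $\{p\mapsto\sigma p:\sigma\in\mathrm{Aut}(\mathfrak C)\}$ in $S_X(\mathfrak C)^{S_X(\mathfrak C)}$ with the topology of pointwise convergence. For $p_1,\dots,p_n\in S_X(\mathfrak C)$, the *content* $c(p_1,\dots,p_n)$ is the set of all tuples $(\varphi_1(\bar x,\bar y),\dots,\varphi_n(\bar x,\bar y),q(\bar y))$, where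 $\bar y$ is a finite tuple of variables, the $\varphi_i$ are $L$-formulas and $q$ is a complete type over $\emptyset$, such that for some $\bar b\models q$ in $\mathfrak C$ we have $\varphi_i(\bar x,\bar b)\in p_i$ for all $i=1,\dots,n$. **Proposition 4.5.** For all $n$ and all tuples $(q_1,\dots,q_n)$ and $(p_1,\dots,p_n)$ of types in $S_X(\mathfrak C)$, we have $c(q_1,\dots,q_n)\subseteq c(p_1,\dots,p_n)$ if and only if there is $\eta\in EL(S_X(\mathfrak C))$ such that $\eta(p_i)=q_i$ for all $i=1,\dots,n$. Moreover, $S_X(\mathfrak C)$ has at most $2^{2^{\max(l_S,\,2^{|T|})}}$ subflows (closed $\mathrm{Aut}(\mathfrak C)$-invariant subsets); in particular, if $l_S$ is bounded, then $S_X(\mathfrak C)$ has only boundedly many subflows. -/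

import Mathlib

universe u

namespace ManySorted

/-! ## Many-sorted first-order logic -/

/-- `Var Γ s` : the positions of sort `s` in the finite list of sorts `Γ`. It serves as the set of
variables of sort `s` of a finite tuple of variables whose sorts are listed in `Γ`. -/
inductive Var {S : Type u} : List S → S → Type u
  | zero {Γ : List S} {s : S} : Var (s :: Γ) s
  | succ {Γ : List S} {s t : S} (x : Var Γ s) : Var (t :: Γ) s

/-- A many-sorted first-order language: sorts, function symbols with their input sorts and output
sort, and relation symbols with their input sorts. Constants are function symbols with no inputs. -/
structure Signature where
  Srt : Type u
  Fn : List Srt → Srt → Type u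
  Rel : List Srt → Type u

/-- The cardinal usually written `|L|` or `|T|`: the number of symbols (sorts included) plus `ℵ₀`,
i.e. the number of formulas of the language. -/
noncomputable def Signature.size (L : Signature.{u}) : Cardinal.{u} :=
  max Cardinal.aleph0
    (Cardinal.mk L.Srt + Cardinal.mk (Σ (Γ : List L.Srt) (s : L.Srt), L.Fn Γ s) +
      Cardinal.mk (Σ Γ : List L.Srt, L.Rel Γ))

variable {L : Signature.{u}}

/-- Tuples of elements of the sorted set `M`, with one entry of sort `s` for each `x : V s`.
Thus `Tuple V M` is the product of the sorts of `M` in which the sort `s` is repeated `V s` times. -/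
abbrev Tuple {S : Type u} (V M : S → Type u) : Type u := ∀ s, V s → M s

/-- The variables of `V` together with those of `W`. -/
abbrev Join {S : Type u} (V W : S → Type u) : S → Type u := fun s => V s ⊕ W s

/-- The concatenation of two tuples. -/
def Tuple.join {S : Type u} {V W M : S → Type u} (a : Tuple V M) (b : Tuple W M) :
    Tuple (Join V W) M := fun s => Sum.elim (a s) (b s)

/-- Extend the tuple `a` by a first entry `m` of sort `t`. -/
def Tuple.cons {S : Type u} {M : S → Type u} {Γ : List S} {t : S} (m : M t) (a : Tuple (Var Γ) M) :
    Tuple (Var (t :: Γ)) M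
  | _, Var.zero => m
  | _, Var.succ x => a _ x

/-- The empty tuple. -/
def Tuple.nil {S : Type u} {M : S → Type u} : Tuple (Var ([] : List S)) M := fun _ x => nomatch x

/-- Terms with variables in `V`. -/
inductive Term (L : Signature.{u}) (V : L.Srt → Type u) : L.Srt → Type u
  | var {s : L.Srt} (x : V s) : Term L V s
  | app {Γ : List L.Srt} {s : L.Srt} (f : L.Fn Γ s) (ts : ∀ t, Var Γ t → Term L V t) : Term L V s

/-- Formulas with free variables in `V` and further variables `Var Γ`, which are meant to be bound
by quantifiers outside of the formula. -/
inductive BFormula (L : Signature.{u}) (V : L.Srt → Type u) : List L.Srt → Type u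
  | falsum {Γ : List L.Srt} : BFormula L V Γ
  | eq {Γ : List L.Srt} {s : L.Srt} (t₁ t₂ : Term L (Join V (Var Γ)) s) : BFormula L V Γ
  | rel {Γ Δ : List L.Srt} (R : L.Rel Δ) (ts : ∀ t, Var Δ t → Term L (Join V (Var Γ)) t) :
      BFormula L V Γ
  | imp {Γ : List L.Srt} (φ ψ : BFormula L V Γ) : BFormula L V Γ
  | all {Γ : List L.Srt} (s : L.Srt) (φ : BFormula L V (s :: Γ)) : BFormula L V Γ

/-- First-order formulas with free variables in `V`. -/
abbrev Formula (L : Signature.{u}) (V : L.Srt → Type u) : Type u := BFormula L V []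

/-- Negation. -/
def BFormula.neg {V : L.Srt → Type u} {Γ : List L.Srt} (φ : BFormula L V Γ) : BFormula L V Γ :=
  φ.imp .falsum

/-- Renaming of variables in terms. -/
def Term.rename {V W : L.Srt → Type u} (f : ∀ s, V s → W s) {s : L.Srt} : Term L V s → Term L W s
  | .var x => .var (f _ x)
  | .app g ts => .app g fun t x => (ts t x).rename f

/-- Renaming of free variables in formulas. -/
def BFormula.rename {V W : L.Srt → Type u} (f : ∀ s, V s → W s) {Γ : List L.Srt} :
    BFormula L V Γ → BFormula L W Γ
  | .falsum => .falsum
  | .eq t₁ t₂ =>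
      .eq (t₁.rename fun s => Sum.map (f s) id) (t₂.rename fun s => Sum.map (f s) id)
  | .rel R ts => .rel R fun t x => (ts t x).rename fun s => Sum.map (f s) id
  | .imp φ ψ => .imp (φ.rename f) (ψ.rename f)
  | .all s φ => .all s (φ.rename f)

/-- An `L`-structure on the sorted set `M`. -/
class Struct (L : Signature.{u}) (M : L.Srt → Type u) where
  fn : ∀ {Γ : List L.Srt} {s : L.Srt}, L.Fn Γ s → Tuple (Var Γ) M → M s
  rel : ∀ {Γ : List L.Srt}, L.Rel Γ → Tuple (Var Γ) M → Prop

section Semantics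

variable {M : L.Srt → Type u} [Struct L M] {V W : L.Srt → Type u}

/-- The value of a term. -/
def Term.val (a : Tuple V M) {s : L.Srt} : Term L V s → M s
  | .var x => a _ x
  | .app f ts => Struct.fn f fun t x => (ts t x).val a

/-- Satisfaction, with an assignment for both kinds of variables. -/
def BFormula.Sat (a : Tuple V M) : {Γ : List L.Srt} → Tuple (Var Γ) M → BFormula L V Γ → Prop
  | _, _, .falsum => False
  | _, w, .eq t₁ t₂ => t₁.val (a.join w) = t₂.val (a.join w)
  | _, w, .rel R ts => Struct.rel R fun t x => (ts t x).val (a.join w)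
  | _, w, .imp φ ψ => φ.Sat a w → ψ.Sat a w
  | _, w, .all s φ => ∀ m : M s, φ.Sat a (w.cons m)

/-- `φ.Holds a` : the formula `φ` is true at the tuple `a`. -/
def Formula.Holds (φ : Formula L V) (a : Tuple V M) : Prop := BFormula.Sat a Tuple.nil φ

/-- `tp a` is the complete type of the tuple `a` over `∅`. -/
def tp (a : Tuple V M) : Set (Formula L V) := {φ | φ.Holds a}

end Semantics

/-! ## Automorphisms -/

/-- Automorphisms of the structure `M`. -/
@[ext]
structure Aut (L : Signature.{u}) (M : L.Srt → Type u) [Struct L M] where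
  toEquiv : ∀ s, M s ≃ M s
  map_fn : ∀ {Γ : List L.Srt} {s : L.Srt} (f : L.Fn Γ s) (a : Tuple (Var Γ) M),
    toEquiv s (Struct.fn f a) = Struct.fn f fun t x => toEquiv t (a t x)
  map_rel : ∀ {Γ : List L.Srt} (R : L.Rel Γ) (a : Tuple (Var Γ) M),
    Struct.rel R (fun t x => toEquiv t (a t x)) ↔ Struct.rel R a

section Automorphisms

variable {M : L.Srt → Type u} [Struct L M] {V : L.Srt → Type u}

/-- An automorphism applied to a tuple, entry by entry. -/
def Aut.map (g : Aut L M) (a : Tuple V M) : Tuple V M := fun s x => g.toEquiv s (a s x)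

instance : Mul (Aut L M) where
  mul g h :=
    { toEquiv := fun s => (h.toEquiv s).trans (g.toEquiv s)
      map_fn := fun f a => by simp [h.map_fn, g.map_fn]
      map_rel := fun R a =>
        (g.map_rel R fun t x => h.toEquiv t (a t x)).trans (h.map_rel R a) }

instance : One (Aut L M) where
  one :=
    { toEquiv := fun _ => Equiv.refl _
      map_fn := fun _ _ => rfl
      map_rel := fun _ _ => Iff.rfl }

instance : Inv (Aut L M) where
  inv g :=
    { toEquiv := fun s => (g.toEquiv s).symm
      map_fn := fun f a => by
        rw [Equiv.symm_apply_eq, g.map_fn]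
        simp
      map_rel := fun R a => by
        rw [← g.map_rel R]
        simp }

instance : Group (Aut L M) where
  mul_assoc _ _ _ := rfl
  one_mul _ := rfl
  mul_one _ := rfl
  inv_mul_cancel g := by
    apply Aut.ext
    funext s
    exact (g.toEquiv s).self_trans_symm

theorem Aut.map_mul (g h : Aut L M) (a : Tuple V M) : (g * h).map a = g.map (h.map a) := rfl

theorem Aut.map_one (a : Tuple V M) : (1 : Aut L M).map a = a := rfl

theorem Aut.map_join (g : Aut L M) {W : L.Srt → Type u} (a : Tuple V M) (b : Tuple W M) :
    g.map (a.join b) = (g.map a).join (g.map b) := by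
  funext s x
  cases x <;> rfl

theorem Aut.val_map (g : Aut L M) (a : Tuple V M) {s : L.Srt} (t : Term L V s) :
    t.val (g.map a) = g.toEquiv s (t.val a) := by
  induction t with
  | var x => rfl
  | app f ts ih => simp only [Term.val, ih, g.map_fn]

theorem Aut.sat_map (g : Aut L M) (a : Tuple V M) {Γ : List L.Srt} (φ : BFormula L V Γ)
    (w : Tuple (Var Γ) M) : φ.Sat (g.map a) (g.map w) ↔ φ.Sat a w := by
  induction φ with
  | falsum => exact Iff.rfl
  | eq t₁ t₂ => simp only [BFormula.Sat, ← g.map_join, g.val_map, EmbeddingLike.apply_eq_iff_eq]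
  | rel R ts => simp only [BFormula.Sat, ← g.map_join, g.val_map, g.map_rel]
  | imp φ ψ ihφ ihψ => simp only [BFormula.Sat, ihφ, ihψ]
  | all s φ ih =>
    simp only [BFormula.Sat]
    have key : ∀ m : M s, Tuple.cons (g.toEquiv s m) (g.map w) = g.map (Tuple.cons m w) := by
      intro m
      funext t x
      cases x <;> rfl
    constructor
    · intro h m
      rw [← ih, ← key]
      exact h _
    · intro h m
      have := (ih (Tuple.cons ((g.toEquiv s).symm m) w)).2 (h _)
      rwa [← key, Equiv.apply_symm_apply] at this

theorem Aut.holds_map (g : Aut L M) (a : Tuple V M) (φ : Formula L V) :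
    φ.Holds (g.map a) ↔ φ.Holds a := by
  have h : (Tuple.nil : Tuple (Var ([] : List L.Srt)) M) = g.map Tuple.nil := by
    funext s x
    cases x
  unfold Formula.Holds
  conv_lhs => rw [h]
  exact g.sat_map a φ _

end Automorphisms

/-! ## Formulas with parameters and complete types -/

/-- A formula `φ(x, b)` with parameters from `M`: an `L`-formula `φ(x, y)`, where `x` are the
variables `V` and `y` is a finite tuple of variables, with a finite tuple `b` put in place of `y`. -/
structure PFormula (L : Signature.{u}) (M V : L.Srt → Type u) where
  ctx : List L.Srt
  form : Formula L (Join V (Var ctx))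
  par : Tuple (Var ctx) M

section Types

variable {M : L.Srt → Type u} [Struct L M] {V : L.Srt → Type u}

/-- The negation of `φ(x, b)`. -/
def PFormula.neg (φ : PFormula L M V) : PFormula L M V := ⟨φ.ctx, φ.form.neg, φ.par⟩

/-- An `L`-formula as a formula with (no) parameters. -/
def PFormula.ofFormula (φ : Formula L V) : PFormula L M V :=
  ⟨[], φ.rename fun _ => Sum.inl, Tuple.nil⟩

/-- `M ⊨ φ(a, b)`. -/
def PFormula.Holds (φ : PFormula L M V) (a : Tuple V M) : Prop := φ.form.Holds (a.join φ.par)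

/-- The formula `φ(x, g(b))`. -/
def PFormula.map (g : Aut L M) (φ : PFormula L M V) : PFormula L M V :=
  ⟨φ.ctx, φ.form, g.map φ.par⟩

/-- All parameters of `φ(x, b)` lie in `A`. -/
def PFormula.ParamsIn (φ : PFormula L M V) (A : ∀ s, Set (M s)) : Prop :=
  ∀ s (y : Var φ.ctx s), φ.par s y ∈ A s

/-- Every finite subset of `p` is satisfied by a tuple in `M`. -/
def FinSat (p : Set (PFormula L M V)) : Prop :=
  ∀ F : Finset (PFormula L M V), (F : Set (PFormula L M V)) ⊆ p →
    ∃ a : Tuple V M, ∀ φ ∈ F, φ.Holds a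

/-- Complete types over `M` in the variables `V`: complete finitely satisfiable sets of formulas
with parameters from `M`. This is the space `S_S(M)`, for `S` the product of sorts in which each
sort `s` is repeated `V s` times. -/
@[ext]
structure CType (L : Signature.{u}) (M : L.Srt → Type u) [Struct L M] (V : L.Srt → Type u) where
  carrier : Set (PFormula L M V)
  finSat : FinSat carrier
  complete : ∀ φ, φ ∈ carrier ∨ φ.neg ∈ carrier

instance : Membership (PFormula L M V) (CType L M V) := ⟨fun p φ => φ ∈ p.carrier⟩

/-- The logic topology: basic open sets are `{p | φ(x, b) ∈ p}`. -/
instance : TopologicalSpace (CType L M V) :=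
  TopologicalSpace.generateFrom {U | ∃ φ : PFormula L M V, U = {p | φ ∈ p}}

theorem PFormula.holds_map (g : Aut L M) (φ : PFormula L M V) (a : Tuple V M) :
    (φ.map g).Holds (g.map a) ↔ φ.Holds a := by
  unfold PFormula.Holds PFormula.map
  rw [← g.map_join]
  exact g.holds_map _ _

theorem PFormula.map_map (g h : Aut L M) (φ : PFormula L M V) :
    (φ.map h).map g = φ.map (g * h) := rfl

theorem PFormula.map_one (φ : PFormula L M V) : φ.map 1 = φ := rfl

/-- `g • p = {φ(x, g(b)) | φ(x, b) ∈ p}`. -/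
instance : MulAction (Aut L M) (CType L M V) where
  smul g p :=
    { carrier := {φ | φ.map g⁻¹ ∈ p}
      finSat := by
        classical
        intro F hF
        obtain ⟨a, ha⟩ := p.finSat (F.image (PFormula.map g⁻¹)) (by
          intro φ hφ
          obtain ⟨ψ, hψ, rfl⟩ := Finset.mem_image.1 (Finset.mem_coe.1 hφ)
          exact hF hψ)
        refine ⟨g.map a, fun φ hφ => ?_⟩
        have h := ha _ (Finset.mem_image_of_mem (PFormula.map g⁻¹) hφ)
        rw [← PFormula.holds_map g, PFormula.map_map, mul_inv_cancel] at h
        exact h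
      complete := fun φ => p.complete (φ.map g⁻¹) }
  one_smul p := by
    apply CType.ext
    ext φ
    change φ.map (1 : Aut L M)⁻¹ ∈ p.carrier ↔ _
    rw [inv_one]
    exact Iff.rfl
  mul_smul g h p := by
    apply CType.ext
    ext φ
    change φ.map (g * h)⁻¹ ∈ p.carrier ↔ (φ.map g⁻¹).map h⁻¹ ∈ p.carrier
    rw [mul_inv_rev, PFormula.map_map]

theorem CType.mem_smul (g : Aut L M) (p : CType L M V) (φ : PFormula L M V) :
    φ ∈ g • p ↔ φ.map g⁻¹ ∈ p := Iff.rfl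

/-- A `∅`-type-definable set `X` is given by a partial type over `∅`, that is, a set of
`L`-formulas in the variables `V`. `TypesOn M X` is the space `S_X(M)` of complete types over `M`
that are concentrated on `X`. -/
def TypesOn (M : L.Srt → Type u) [Struct L M] (X : Set (Formula L V)) : Type u :=
  {p : CType L M V // ∀ φ ∈ X, PFormula.ofFormula φ ∈ p}

variable {X : Set (Formula L V)}

instance : TopologicalSpace (TypesOn M X) :=
  inferInstanceAs (TopologicalSpace {p : CType L M V // ∀ φ ∈ X, PFormula.ofFormula φ ∈ p})

theorem PFormula.map_ofFormula (g : Aut L M) (φ : Formula L V) :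
    (PFormula.ofFormula φ : PFormula L M V).map g = PFormula.ofFormula φ := by
  have h : g.map (Tuple.nil : Tuple (Var ([] : List L.Srt)) M) = Tuple.nil := by
    funext s x
    cases x
  unfold PFormula.map PFormula.ofFormula
  rw [h]

instance : MulAction (Aut L M) (TypesOn M X) where
  smul g p := ⟨g • p.1, fun φ hφ => by
    rw [CType.mem_smul, PFormula.map_ofFormula]
    exact p.2 φ hφ⟩
  one_smul p := Subtype.ext (one_smul _ p.1)
  mul_smul g h p := Subtype.ext (mul_smul g h p.1)

end Types

/-! ## Monster models -/

section Monster

/-- `κ`-saturation: every finitely satisfiable set of formulas in one variable, with parameters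
from a set of size less than `κ`, is realized. -/
def IsSaturated (L : Signature.{u}) (M : L.Srt → Type u) [Struct L M] (κ : Cardinal.{u}) : Prop :=
  ∀ (s : L.Srt) (A : ∀ t, Set (M t)), Cardinal.mk (Σ t, A t) < κ →
    ∀ p : Set (PFormula L M (Var [s])), (∀ φ ∈ p, φ.ParamsIn A) → FinSat p →
      ∃ a : Tuple (Var [s]) M, ∀ φ ∈ p, φ.Holds a

/-- Strong `κ`-homogeneity: tuples of length less than `κ` with the same type over `∅` are
conjugate under an automorphism. -/
def IsStronglyHomogeneous (L : Signature.{u}) (M : L.Srt → Type u) [Struct L M]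
    (κ : Cardinal.{u}) : Prop :=
  ∀ W : L.Srt → Type u, Cardinal.mk (Σ t, W t) < κ →
    ∀ a b : Tuple W M, tp a = tp b → ∃ g : Aut L M, g.map a = b

/-- `M` is a monster model (of its complete theory), with degree of saturation the strong limit
cardinal `κ`. -/
structure IsMonster (L : Signature.{u}) (M : L.Srt → Type u) [Struct L M]
    (κ : Cardinal.{u}) : Prop where
  strongLimit : κ.IsStrongLimit
  size_lt : L.size < κ
  saturated : IsSaturated L M κ
  homogeneous : IsStronglyHomogeneous L M κ

end Monster

/-! ## Flows -/

section Flows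

/-- The Ellis semigroup of the flow `(G, Y)`: the closure, in `Y → Y` with the topology of
pointwise convergence, of the set of maps `y ↦ g • y`, `g ∈ G`. -/
def EL (G Y : Type u) [Group G] [MulAction G Y] [TopologicalSpace Y] : Set (Y → Y) :=
  closure (Set.range fun (g : G) (y : Y) => g • y)

/-- Subflows: closed `G`-invariant subsets. -/
def IsSubflow (G : Type u) {Y : Type u} [Group G] [MulAction G Y] [TopologicalSpace Y]
    (Z : Set Y) : Prop :=
  IsClosed Z ∧ ∀ (g : G), ∀ y ∈ Z, g • y ∈ Z

end Flows

/-! ## Content -/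

section Content

/-- The tuples `(φ₁(x, y), …, φₙ(x, y), q(y))`, where the `φᵢ` are `L`-formulas, `y` is a finite
tuple of variables (with sorts listed in `ctx`), and `q` is a set of `L`-formulas in `y`. -/
structure Config (L : Signature.{u}) (V : L.Srt → Type u) (n : ℕ) where
  ctx : List L.Srt
  form : Fin n → Formula L (Join V (Var ctx))
  type : Set (Formula L (Var ctx))

variable {M : L.Srt → Type u} [Struct L M] {V : L.Srt → Type u}

/-- The content `c(p₁, …, pₙ)`: the set of all `(φ₁(x, y), …, φₙ(x, y), q(y))` such that there is
a tuple `b` in `M` with `q = tp(b/∅)` and `φᵢ(x, b) ∈ pᵢ` for all `i`. -/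
def content {n : ℕ} (p : Fin n → CType L M V) : Set (Config L V n) :=
  {c | ∃ b : Tuple (Var c.ctx) M, c.type = tp b ∧ ∀ i, (⟨c.ctx, c.form i, b⟩ : PFormula L M V) ∈ p i}

end Content

end ManySorted

/-! The first claim is a statement about orbit closures. `S_X(C)` is compact Hausdorff, so
evaluating the Ellis semigroup at `(p₁, …, pₙ)` gives exactly the closure of the `Aut(C)`-orbit of
that tuple (`exists_mem_EL_iff`). It remains to see that `q` lies in this closure if and only if
`c(q) ⊆ c(p)`.

Membership in the closure means that every basic box around `q` meets the orbit. Such a box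
prescribes one formula in each coordinate, and all of these can be written with a single finite
parameter tuple `b`. Some translate `g • p` lies in the box exactly when `p` contains the same
formulas at `g⁻¹(b)`. By strong homogeneity, the tuples `g⁻¹(b)` are exactly those with the type of
`b`, so the condition is that `c(p)` contains the corresponding configuration
(`content_subset_of_mem_closure`, `mem_closure_of_content_subset`).

For the bound, a subflow is closed under the Ellis semigroup, so the case `n = 1` shows that it is
determined by the set of contents of its points (`mk_subflow_le`). A content is a set of
configurations, whence two exponentials over the number of configurations. `Config.mk_le` estimates
that number by coding formulas as finitely branching trees. -/

namespace ManySorted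

/-! ## Merging finite tuples of parameters -/

/-- The embedding of the variables of `Γ` into those of `Γ ++ Δ`. -/
def Var.inl {S : Type u} {Δ : List S} : {Γ : List S} → {s : S} → Var Γ s → Var (Γ ++ Δ) s
  | _, _, .zero => .zero
  | _, _, .succ x => .succ x.inl

/-- The embedding of the variables of `Δ` into those of `Γ ++ Δ`. -/
def Var.inr {S : Type u} {Δ : List S} : (Γ : List S) → {s : S} → Var Δ s → Var (Γ ++ Δ) s
  | [], _, x => x
  | _ :: Γ, _, x => .succ (Var.inr Γ x)

/-- The concatenation of two finite tuples. -/
def Tuple.append {S : Type u} {M : S → Type u} {Δ : List S} (b : Tuple (Var Δ) M) :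
    (Γ : List S) → Tuple (Var Γ) M → Tuple (Var (Γ ++ Δ)) M
  | [], _ => b
  | _ :: Γ, a => Tuple.cons (a _ .zero) (Tuple.append b Γ fun _ x => a _ x.succ)

theorem Tuple.append_inl {S : Type u} {M : S → Type u} {Δ : List S} (b : Tuple (Var Δ) M)
    {Γ : List S} (a : Tuple (Var Γ) M) {s : S} (x : Var Γ s) :
    Tuple.append b Γ a s x.inl = a s x := by
  induction x with
  | zero => rfl
  | succ x ih => exact ih fun _ x => a _ x.succ

theorem Tuple.append_inr {S : Type u} {M : S → Type u} {Δ : List S} (b : Tuple (Var Δ) M)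
    (Γ : List S) (a : Tuple (Var Γ) M) {s : S} (x : Var Δ s) :
    Tuple.append b Γ a s (Var.inr Γ x) = b s x := by
  induction Γ with
  | nil => rfl
  | cons t Γ ih => exact ih fun _ x => a _ x.succ

section Rename

variable {M : L.Srt → Type u} [Struct L M] {V W : L.Srt → Type u}

theorem Term.val_rename (f : ∀ s, V s → W s) (a : Tuple W M) {s : L.Srt} (t : Term L V s) :
    (t.rename f).val a = t.val fun s x => a s (f s x) := by
  induction t with
  | var x => rfl
  | app g ts ih => simp only [Term.rename, Term.val, ih]

theorem BFormula.sat_rename (f : ∀ s, V s → W s) (a : Tuple W M) {Γ : List L.Srt}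
    (φ : BFormula L V Γ) (w : Tuple (Var Γ) M) :
    (φ.rename f).Sat a w ↔ φ.Sat (fun s x => a s (f s x)) w := by
  have key : ∀ {Γ : List L.Srt} (w : Tuple (Var Γ) M),
      (fun s x => a.join w s (Sum.map (f s) id x)) = Tuple.join (fun s x => a s (f s x)) w := by
    intro Γ w
    funext s x
    cases x <;> rfl
  induction φ with
  | falsum => exact Iff.rfl
  | eq t₁ t₂ => simp only [BFormula.rename, BFormula.Sat, Term.val_rename, key]
  | rel R ts => simp only [BFormula.rename, BFormula.Sat, Term.val_rename, key]
  | imp φ ψ ihφ ihψ => simp only [BFormula.rename, BFormula.Sat, ihφ, ihψ]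
  | all s φ ih => simp only [BFormula.rename, BFormula.Sat, ih]

theorem Formula.holds_rename (f : ∀ s, V s → W s) (a : Tuple W M) (φ : Formula L V) :
    Formula.Holds (BFormula.rename f φ) a ↔ φ.Holds fun s x => a s (f s x) :=
  BFormula.sat_rename f a φ _

/-- Finitely many formulas with parameters can be written with one common tuple of parameters. -/
theorem PFormula.exists_common_par {n : ℕ} (φ : Fin n → PFormula L M V) :
    ∃ (Γ : List L.Srt) (b : Tuple (Var Γ) M) (ψ : Fin n → Formula L (Join V (Var Γ))),
      ∀ i a, (⟨Γ, ψ i, b⟩ : PFormula L M V).Holds a ↔ (φ i).Holds a := by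
  induction n with
  | zero => exact ⟨[], Tuple.nil, fun i => i.elim0, fun i => i.elim0⟩
  | succ n ih =>
    obtain ⟨Γ, b, ψ, h⟩ := ih fun i => φ i.succ
    -- The parameters of the first formula are put in front of the common tuple of the others; each
    -- formula is renamed to read only its own block.
    refine ⟨(φ 0).ctx ++ Γ, Tuple.append b _ (φ 0).par,
      Fin.cases ((φ 0).form.rename fun s => Sum.map id Var.inl)
        fun i => (ψ i).rename fun s => Sum.map id (Var.inr _), fun i a => ?_⟩
    refine Fin.cases ?_ (fun i => ?_) i
    · refine (Formula.holds_rename _ _ _).trans (iff_of_eq (congrArg _ ?_))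
      funext s x
      cases x with
      | inl x => rfl
      | inr x => exact Tuple.append_inl _ _ _
    · refine ((Formula.holds_rename _ _ _).trans (iff_of_eq (congrArg _ ?_))).trans (h i a)
      funext s x
      cases x with
      | inl x => rfl
      | inr x => exact Tuple.append_inr _ _ _ _

/-- Conjunctions of formulas with parameters. -/
theorem PFormula.exists_and (φ ψ : PFormula L M V) :
    ∃ χ : PFormula L M V, ∀ a, χ.Holds a ↔ φ.Holds a ∧ ψ.Holds a := by
  obtain ⟨Γ, b, θ, h⟩ := PFormula.exists_common_par ![φ, ψ]
  refine ⟨⟨Γ, BFormula.neg ((θ 0).imp (θ 1).neg), b⟩, fun a => ?_⟩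
  have h0 := h 0 a
  have h1 := h 1 a
  simp only [Matrix.cons_val_zero, Matrix.cons_val_one] at h0 h1
  rw [← h0, ← h1]
  simp only [PFormula.Holds, Formula.Holds, BFormula.neg, BFormula.Sat]
  tauto

/-! ## Complete types -/

/-- Otherwise completeness puts `χ.neg` into `p`, and `F` together with `χ.neg` is a finite subset
of `p` that no tuple satisfies. -/
theorem CType.mem_of_forall (p : CType L M V) (F : Finset (PFormula L M V))
    (hF : ∀ φ ∈ F, φ ∈ p) (χ : PFormula L M V) (h : ∀ a, (∀ φ ∈ F, φ.Holds a) → χ.Holds a) :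
    χ ∈ p := by
  classical
  refine (p.complete χ).resolve_right fun hχ => ?_
  obtain ⟨a, ha⟩ := p.finSat (insert χ.neg F) (by
    intro φ hφ
    rcases Finset.mem_insert.1 (Finset.mem_coe.1 hφ) with rfl | hφ
    exacts [hχ, hF φ hφ])
  exact ha _ (Finset.mem_insert_self _ _) (h a fun φ hφ => ha φ (Finset.mem_insert_of_mem hφ))

theorem CType.mem_of_imp (p : CType L M V) {φ χ : PFormula L M V} (hφ : φ ∈ p)
    (h : ∀ a, φ.Holds a → χ.Holds a) : χ ∈ p :=
  p.mem_of_forall {φ} (by simpa using hφ) χ fun a ha => h a (ha φ (Finset.mem_singleton_self φ))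

theorem CType.neg_mem_iff (p : CType L M V) (φ : PFormula L M V) : φ.neg ∈ p ↔ φ ∉ p := by
  classical
  refine ⟨fun h h' => ?_, fun h => (p.complete φ).resolve_left h⟩
  obtain ⟨a, ha⟩ := p.finSat {φ, φ.neg} (by
    intro ψ hψ
    simp only [Finset.coe_insert, Finset.coe_singleton, Set.mem_insert_iff,
      Set.mem_singleton_iff] at hψ
    rcases hψ with rfl | rfl
    exacts [h', h])
  exact ha φ.neg (by simp) (ha φ (by simp))

theorem CType.isOpen_mem (φ : PFormula L M V) : IsOpen {p : CType L M V | φ ∈ p} :=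
  TopologicalSpace.isOpen_generateFrom_of_mem ⟨φ, rfl⟩

theorem CType.isClosed_mem (φ : PFormula L M V) : IsClosed {p : CType L M V | φ ∈ p} := by
  constructor
  convert CType.isOpen_mem φ.neg using 1
  ext p
  exact (p.neg_mem_iff φ).symm

instance : T2Space (CType L M V) := by
  refine ⟨fun p q hpq => ?_⟩
  obtain ⟨φ, hφ⟩ : ∃ φ, ¬ (φ ∈ p ↔ φ ∈ q) := by
    by_contra! h
    exact hpq (CType.ext (Set.ext h))
  by_cases hp : φ ∈ p
  · refine ⟨_, _, CType.isOpen_mem φ, CType.isOpen_mem φ.neg, hp,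
      (q.neg_mem_iff φ).2 (by tauto), ?_⟩
    exact Set.disjoint_left.2 fun r h h' => (r.neg_mem_iff φ).1 h' h
  · refine ⟨_, _, CType.isOpen_mem φ.neg, CType.isOpen_mem φ, (p.neg_mem_iff φ).2 hp,
      (by tauto : φ ∈ q), ?_⟩
    exact Set.disjoint_left.2 fun r h h' => (r.neg_mem_iff φ).1 h h'

/-- The limit of an ultrafilter on the space of complete types. -/
def CType.lim (U : Ultrafilter (CType L M V)) : CType L M V where
  carrier := {φ | {r : CType L M V | φ ∈ r} ∈ U}
  finSat := by
    intro F hF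
    have h : (⋂ φ ∈ F, {r : CType L M V | φ ∈ r}) ∈ (U : Filter (CType L M V)) :=
      (Filter.biInter_finset_mem F).2 fun φ hφ => hF hφ
    obtain ⟨r, hr⟩ := U.nonempty_of_mem h
    exact r.finSat F fun φ hφ => Set.mem_iInter₂.1 hr φ hφ
  complete φ := by
    refine (Ultrafilter.mem_or_compl_mem U {r : CType L M V | φ ∈ r}).imp id fun h => ?_
    filter_upwards [h] with r hr
    exact (r.neg_mem_iff φ).2 hr

/-- Every ultrafilter converges to its `CType.lim`: it suffices to test subbasic neighbourhoods, and
these belong to the ultrafilter by the definition of the limit. -/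
instance : CompactSpace (CType L M V) := by
  refine ⟨isCompact_iff_ultrafilter_le_nhds.2 fun U _ => ⟨CType.lim U, trivial, ?_⟩⟩
  rw [TopologicalSpace.nhds_generateFrom]
  refine le_iInf₂ fun s hs => ?_
  obtain ⟨h, φ, rfl⟩ := hs
  exact Filter.le_principal_iff.2 h

/-- The sets `{r | φ(x, b) ∈ r}` form a basis of the logic topology. -/
theorem CType.exists_mem_of_isOpen {U : Set (CType L M V)} (hU : IsOpen U) {p : CType L M V}
    (hp : p ∈ U) : ∃ φ ∈ p, ∀ r : CType L M V, φ ∈ r → r ∈ U := by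
  induction hU with
  | basic U hU =>
    obtain ⟨φ, rfl⟩ := hU
    exact ⟨φ, hp, fun r h => h⟩
  | univ =>
    exact ⟨⟨[], BFormula.neg .falsum, Tuple.nil⟩,
      p.mem_of_forall ∅ (by simp) _ fun a _ h => h, fun _ _ => trivial⟩
  | inter U U' _ _ ih ih' =>
    classical
    obtain ⟨φ, hφ, h⟩ := ih hp.1
    obtain ⟨ψ, hψ, h'⟩ := ih' hp.2
    obtain ⟨χ, hχ⟩ := PFormula.exists_and φ ψ
    refine ⟨χ, p.mem_of_forall {φ, ψ} ?_ χ fun a ha => (hχ a).2 ⟨ha φ (by simp), ha ψ (by simp)⟩,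
      fun r hr => ⟨h r (r.mem_of_imp hr fun a ha => ((hχ a).1 ha).1),
        h' r (r.mem_of_imp hr fun a ha => ((hχ a).1 ha).2)⟩⟩
    intro θ hθ
    rcases Finset.mem_insert.1 hθ with rfl | hθ
    · exact hφ
    · rwa [Finset.mem_singleton.1 hθ]
  | sUnion S _ ih =>
    obtain ⟨U, hUS, hpU⟩ := hp
    obtain ⟨φ, hφ, h⟩ := ih U hUS hpU
    exact ⟨φ, hφ, fun r hr => ⟨U, hUS, h r hr⟩⟩

variable {X : Set (Formula L V)}

instance : T2Space (TypesOn M X) :=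
  inferInstanceAs (T2Space {p : CType L M V // ∀ φ ∈ X, PFormula.ofFormula φ ∈ p})

instance : CompactSpace (TypesOn M X) := by
  refine isCompact_iff_compactSpace.1
    (IsClosed.isCompact (s := {p : CType L M V | ∀ φ ∈ X, PFormula.ofFormula φ ∈ p}) ?_)
  simp only [Set.ofPred_forall]
  exact isClosed_biInter fun φ _ => CType.isClosed_mem _

theorem TypesOn.isOpen_mem (φ : PFormula L M V) : IsOpen {p : TypesOn M X | φ ∈ p.1} :=
  (CType.isOpen_mem φ).preimage continuous_subtype_val

theorem TypesOn.exists_mem_of_isOpen {U : Set (TypesOn M X)} (hU : IsOpen U) {p : TypesOn M X}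
    (hp : p ∈ U) : ∃ φ ∈ p.1, ∀ r : TypesOn M X, φ ∈ r.1 → r ∈ U := by
  obtain ⟨U', hU', rfl⟩ := isOpen_induced_iff.1 hU
  obtain ⟨φ, hφ, h⟩ := CType.exists_mem_of_isOpen hU' hp
  exact ⟨φ, hφ, fun r hr => h r.1 hr⟩

end Rename

/-! ## The Ellis semigroup -/

section Ellis

variable {G Y : Type u} [Group G] [MulAction G Y] [TopologicalSpace Y]

/-- In a compact Hausdorff flow, the closure of the orbit of a tuple of points is the orbit of
that tuple under the Ellis semigroup. -/
theorem exists_mem_EL_iff [CompactSpace Y] [T2Space Y] {ι : Type*} (p q : ι → Y) :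
    (∃ η ∈ EL G Y, ∀ i, η (p i) = q i) ↔
      q ∈ closure (Set.range fun (g : G) (i : ι) => g • p i) := by
  have hcont : Continuous fun (η : Y → Y) (i : ι) => η (p i) :=
    continuous_pi fun i => continuous_apply (p i)
  -- `EL G Y` is closed in the compact space `Y → Y`, so the continuous evaluation at `p` maps the
  -- closure of the translations onto the closure of their image.
  have himage := image_closure_of_isCompact
    (isClosed_closure (s := Set.range fun (g : G) (y : Y) => g • y)).isCompact
    hcont.continuousOn
  rw [← Set.range_comp] at himage
  change _ ↔ q ∈ closure (Set.range ((fun (η : Y → Y) (i : ι) => η (p i)) ∘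
    fun (g : G) (y : Y) => g • y))
  rw [← himage]
  simp only [Set.mem_image, funext_iff, EL]

/-- The maps sending `y` into `Z` form a closed set containing all translations. -/
theorem IsSubflow.apply_mem {Z : Set Y} (hZ : IsSubflow G Z) {η : Y → Y} (hη : η ∈ EL G Y) {y : Y}
    (hy : y ∈ Z) : η y ∈ Z := by
  refine closure_minimal ?_ (hZ.1.preimage (continuous_apply y)) hη
  rintro _ ⟨g, rfl⟩
  exact hZ.2 g y hy

end Ellis

/-! ## Content and orbit closures -/

theorem Var.finite_sigma {S : Type u} (Γ : List S) : Finite (Σ s, Var Γ s) := by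
  induction Γ with
  | nil =>
    have : IsEmpty (Σ s, Var ([] : List S) s) := ⟨fun x => nomatch x.2⟩
    infer_instance
  | cons t Γ ih =>
    refine Finite.of_surjective
      (fun o : Option (Σ s, Var Γ s) => (o.elim ⟨t, .zero⟩ fun x => ⟨x.1, x.2.succ⟩ :
        Σ s, Var (t :: Γ) s)) ?_
    rintro ⟨s, x⟩
    cases x with
    | zero => exact ⟨none, rfl⟩
    | succ x => exact ⟨some ⟨s, x⟩, rfl⟩

theorem Signature.aleph0_le_size (L : Signature.{u}) : Cardinal.aleph0 ≤ L.size := le_max_left _ _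

section Content

variable {M : L.Srt → Type u} [Struct L M] {V : L.Srt → Type u} {X : Set (Formula L V)}

/-- Containing given formulas with parameters `b` is an open condition on a tuple of types, so some
translate of `p` shares it with `q`. -/
theorem content_subset_of_mem_closure {n : ℕ} {p q : Fin n → TypesOn M X}
    (h : q ∈ closure (Set.range fun (g : Aut L M) i => g • p i)) :
    content (fun i => (q i).1) ⊆ content (fun i => (p i).1) := by
  rintro c ⟨b, hb, hc⟩
  obtain ⟨_, hr, g, rfl⟩ := mem_closure_iff.1 h
    (Set.univ.pi fun i => {r : TypesOn M X | (⟨c.ctx, c.form i, b⟩ : PFormula L M V) ∈ r.1})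
    (isOpen_set_pi Set.finite_univ fun i _ => TypesOn.isOpen_mem _) fun i _ => hc i
  -- By the definition of the action, `φ(x, b) ∈ g • p` is the same as `φ(x, g⁻¹(b)) ∈ p`.
  refine ⟨g⁻¹.map b, ?_, fun i => hr i trivial⟩
  rw [hb]
  exact Set.ext fun φ => (g⁻¹.holds_map b φ).symm

theorem mem_closure_of_content_subset {κ : Cardinal.{u}} (hκ : Cardinal.aleph0 ≤ κ)
    (hM : IsStronglyHomogeneous L M κ) {n : ℕ} {p q : Fin n → TypesOn M X}
    (h : content (fun i => (q i).1) ⊆ content (fun i => (p i).1)) :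
    q ∈ closure (Set.range fun (g : Aut L M) i => g • p i) := by
  refine mem_closure_iff.2 fun U hU hq => ?_
  obtain ⟨u, hu, hsub⟩ := isOpen_pi_iff'.1 hU q hq
  choose φ hφ hφu using fun i => TypesOn.exists_mem_of_isOpen (hu i).1 (hu i).2
  obtain ⟨Γ, b, ψ, hψ⟩ := PFormula.exists_common_par φ
  -- The inclusion of contents gives `b'` with the type of `b` at which `p` contains the formulas.
  -- An automorphism taking `b'` to `b` then moves `p` into the box.
  obtain ⟨b', hb', hp⟩ := h (show (⟨Γ, ψ, tp b⟩ : Config L V n) ∈ _ from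
    ⟨b, rfl, fun i => (q i).1.mem_of_imp (hφ i) fun a => (hψ i a).2⟩)
  have := Var.finite_sigma Γ
  obtain ⟨g, hg⟩ := hM (Var Γ) ((Cardinal.mk_lt_aleph0).trans_le hκ) b' b hb'.symm
  refine ⟨fun i => g • p i, hsub fun i _ => hφu i _ ?_, g, rfl⟩
  refine (g • p i).1.mem_of_imp (φ := ⟨Γ, ψ i, b⟩) ?_ fun a => (hψ i a).1
  change (⟨Γ, ψ i, g⁻¹.map b⟩ : PFormula L M V) ∈ (p i).1
  rw [← hg, ← Aut.map_mul, inv_mul_cancel, Aut.map_one]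
  exact hp i

theorem content_subset_iff {κ : Cardinal.{u}} (hκ : Cardinal.aleph0 ≤ κ)
    (hM : IsStronglyHomogeneous L M κ) {n : ℕ} (q p : Fin n → TypesOn M X) :
    content (fun i => (q i).1) ⊆ content (fun i => (p i).1) ↔
      ∃ η ∈ EL (Aut L M) (TypesOn M X), ∀ i, η (p i) = q i :=
  ⟨fun h => (exists_mem_EL_iff p q).2 (mem_closure_of_content_subset hκ hM h),
    fun h => content_subset_of_mem_closure ((exists_mem_EL_iff p q).1 h)⟩

/-- A subflow is determined by the contents of its points. -/
theorem mk_subflow_le {κ : Cardinal.{u}} (hκ : Cardinal.aleph0 ≤ κ)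
    (hM : IsStronglyHomogeneous L M κ) :
    Cardinal.mk {Y : Set (TypesOn M X) // IsSubflow (Aut L M) Y} ≤
      2 ^ (2 ^ Cardinal.mk (Config L V 1) : Cardinal.{u}) := by
  let c : TypesOn M X → Set (Config L V 1) := fun p => content fun _ => p.1
  -- If `q ∈ Y` has the content of some `p ∈ Z`, then `q = η p` with `η` in the Ellis semigroup, and
  -- `Z` is closed under `η`.
  have key : ∀ Y Z : {Y : Set (TypesOn M X) // IsSubflow (Aut L M) Y},
      c '' Y.1 = c '' Z.1 → Y.1 ⊆ Z.1 := by
    intro Y Z h q hq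
    obtain ⟨p, hp, hpq⟩ : c q ∈ c '' Z.1 := h ▸ Set.mem_image_of_mem c hq
    obtain ⟨η, hη, hηp⟩ :=
      (content_subset_iff hκ hM (fun _ : Fin 1 => q) fun _ => p).1 hpq.ge
    exact hηp 0 ▸ Z.2.apply_mem hη hp
  rw [← Cardinal.mk_set, ← Cardinal.mk_set]
  exact Cardinal.mk_le_of_injective (f := fun Y => c '' Y.1) fun Y Z h =>
    Subtype.ext ((key Y Z h).antisymm (key Z Y h.symm))

end Content

/-! ## Counting formulas -/

section Counting

/-- The position of a variable in the list of sorts. -/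
def Var.index {S : Type u} : {Γ : List S} → {s : S} → Var Γ s → ℕ
  | _, _, .zero => 0
  | _, _, .succ x => x.index + 1

theorem Var.index_injective {S : Type u} {Γ : List S} {s : S} :
    Function.Injective (Var.index : Var Γ s → ℕ) := by
  intro x y h
  induction x with
  | zero =>
    cases y with
    | zero => rfl
    | succ y => cases h
  | succ x ih =>
    cases y with
    | zero => cases h
    | succ y => rw [ih (Nat.succ_injective h)]

/-- The labels of the nodes of syntax trees, with labels of variables in `B`. -/
inductive Label (L : Signature.{u}) (B : Type u) : Type u
  | var (x : B)
  | app (f : Σ (Γ : List L.Srt) (s : L.Srt), L.Fn Γ s)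
  | falsum
  | eq (s : L.Srt)
  | rel (R : Σ Γ : List L.Srt, L.Rel Γ)
  | imp
  | all (s : L.Srt)

/-- The positions of the children of a node of a syntax tree. -/
def Label.Arity {B : Type u} : Label L B → Type u
  | .var _ => PEmpty
  | .app f => Σ t, Var f.1 t
  | .falsum => PEmpty
  | .eq _ => ULift Bool
  | .rel R => Σ t, Var R.1 t
  | .imp => ULift Bool
  | .all _ => PUnit

instance {B : Type u} (l : Label L B) : Finite l.Arity := by
  cases l
  case app f => exact Var.finite_sigma f.1
  case rel R => exact Var.finite_sigma R.1
  all_goals unfold Label.Arity; infer_instance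

theorem Label.mk_le (B : Type u) : Cardinal.mk (Label L B) ≤ max (Cardinal.mk B) L.size := by
  let F := Σ (Γ : List L.Srt) (s : L.Srt), L.Fn Γ s
  let R := Σ Γ : List L.Srt, L.Rel Γ
  have hinj : Cardinal.mk (Label L B) ≤ Cardinal.mk (B ⊕ F ⊕ R ⊕ L.Srt ⊕ L.Srt ⊕ ULift Bool) := by
    refine Cardinal.mk_le_of_injective (f := fun l => match l with
      | .var x => .inl x
      | .app f => .inr (.inl f)
      | .rel r => .inr (.inr (.inl r))
      | .eq s => .inr (.inr (.inr (.inl s)))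
      | .all s => .inr (.inr (.inr (.inr (.inl s))))
      | .falsum => .inr (.inr (.inr (.inr (.inr ⟨true⟩))))
      | .imp => .inr (.inr (.inr (.inr (.inr ⟨false⟩))))) ?_
    intro l l' h
    cases l <;> cases l' <;> simp_all
  have h0 : Cardinal.aleph0 ≤ max (Cardinal.mk B) L.size := L.aleph0_le_size.trans (le_max_right _ _)
  have hsum : Cardinal.mk L.Srt + Cardinal.mk F + Cardinal.mk R ≤ max (Cardinal.mk B) L.size :=
    (le_max_right _ _).trans (le_max_right _ _)
  have hS : Cardinal.mk L.Srt ≤ max (Cardinal.mk B) L.size :=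
    (le_self_add.trans le_self_add).trans hsum
  have hF : Cardinal.mk F ≤ max (Cardinal.mk B) L.size :=
    (le_add_self.trans le_self_add).trans hsum
  have hR : Cardinal.mk R ≤ max (Cardinal.mk B) L.size := le_add_self.trans hsum
  have h2 : Cardinal.mk (ULift.{u} Bool) ≤ max (Cardinal.mk B) L.size :=
    Cardinal.mk_le_aleph0.trans h0
  refine hinj.trans ?_
  simp only [Cardinal.mk_sum, Cardinal.lift_id]
  exact Cardinal.add_le_of_le h0 (le_max_left _ _) (Cardinal.add_le_of_le h0 hF
    (Cardinal.add_le_of_le h0 hR (Cardinal.add_le_of_le h0 hS (Cardinal.add_le_of_le h0 hS h2))))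

/-- All arities are finite, so the trees number at most `ℵ₀` or the number of labels, whichever is
larger. -/
theorem mk_tree_le (B : Type u) :
    Cardinal.mk (WType (Label.Arity : Label L B → Type u)) ≤ max (Cardinal.mk B) L.size :=
  WType.cardinalMk_le_max_aleph0_of_finite.trans
    (max_le (Label.mk_le B) (L.aleph0_le_size.trans (le_max_right _ _)))

/-- The syntax tree of a term. -/
def Term.tree {V : L.Srt → Type u} {B : Type u} (f : ∀ s, V s → B) {s : L.Srt} :
    Term L V s → WType (Label.Arity : Label L B → Type u)
  | .var x => ⟨.var (f _ x), PEmpty.elim⟩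
  | .app g ts => ⟨.app ⟨_, _, g⟩, fun x => (ts x.1 x.2).tree f⟩

theorem Term.tree_injective {V : L.Srt → Type u} {B : Type u} {f : ∀ s, V s → B}
    (hf : ∀ s, Function.Injective (f s)) {s : L.Srt} :
    Function.Injective (Term.tree f : Term L V s → _) := by
  intro t t' h
  induction t with
  | var x =>
    cases t' with
    | var x' =>
      injection h with h₁
      injection h₁ with h₁
      rw [hf _ h₁]
    | app g' ts' =>
      injection h with h₁
      cases h₁
  | app g ts ih =>
    cases t' with
    | var x' =>
      injection h with h₁
      cases h₁
    | app g' ts' =>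
      injection h with h₁ h₂
      cases h₁
      congr 1
      funext t x
      exact ih t x (congrFun (eq_of_heq h₂) ⟨t, x⟩)

/-- The labels of the free and bound variables of a formula. -/
def varLabel {S : Type u} (V : S → Type u) (Γ : List S) (s : S) :
    Join V (Var Γ) s → (Σ s, V s) ⊕ ULift.{u} ℕ :=
  Sum.map (Sigma.mk s) fun x => ⟨x.index⟩

/-- A bound variable is labelled by its position alone; within a fixed `Γ` and sort `s` this
determines it. -/
theorem varLabel_injective {S : Type u} (V : S → Type u) (Γ : List S) (s : S) :
    Function.Injective (varLabel V Γ s) :=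
  Sum.map_injective.2 ⟨sigma_mk_injective, fun _ _ h => Var.index_injective (ULift.up_injective h)⟩

/-- The syntax tree of a formula. -/
def BFormula.tree {V : L.Srt → Type u} : {Γ : List L.Srt} → BFormula L V Γ →
    WType (Label.Arity : Label L ((Σ s, V s) ⊕ ULift.{u} ℕ) → Type u)
  | _, .falsum => ⟨.falsum, PEmpty.elim⟩
  | _, .eq (s := s) t₁ t₂ =>
      ⟨.eq s, fun i => cond i.down (t₁.tree (varLabel V _)) (t₂.tree (varLabel V _))⟩
  | _, .rel R ts => ⟨.rel ⟨_, R⟩, fun x => (ts x.1 x.2).tree (varLabel V _)⟩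
  | _, .imp φ ψ => ⟨.imp, fun i => cond i.down φ.tree ψ.tree⟩
  | _, .all s φ => ⟨.all s, fun _ => φ.tree⟩

/-- The root label records the constructor with its symbol or sort, hence also the types of the
immediate constituents, which can then be compared child by child. -/
theorem BFormula.tree_injective {V : L.Srt → Type u} {Γ : List L.Srt} :
    Function.Injective (BFormula.tree : BFormula L V Γ → _) := by
  intro φ ψ h
  induction φ with
  | falsum => cases ψ <;> first | rfl | (injection h with h₁; cases h₁)
  | eq t₁ t₂ =>
    cases ψ
    case eq =>
      injection h with h₁ h₂
      cases h₁
      rw [Term.tree_injective (varLabel_injective V _) (congrFun h₂ ⟨true⟩),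
        Term.tree_injective (varLabel_injective V _) (congrFun h₂ ⟨false⟩)]
    all_goals injection h with h₁; cases h₁
  | rel R ts =>
    cases ψ
    case rel =>
      injection h with h₁ h₂
      cases h₁
      congr 1
      funext t x
      exact Term.tree_injective (varLabel_injective V _) (congrFun (eq_of_heq h₂) ⟨t, x⟩)
    all_goals injection h with h₁; cases h₁
  | imp φ φ' ih ih' =>
    cases ψ
    case imp =>
      injection h with h₁ h₂
      rw [ih (congrFun h₂ ⟨true⟩), ih' (congrFun h₂ ⟨false⟩)]
    all_goals injection h with h₁; cases h₁
  | all s φ ih =>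
    cases ψ
    case all =>
      injection h with h₁ h₂
      cases h₁
      rw [ih (congrFun h₂ ⟨⟩)]
    all_goals injection h with h₁; cases h₁

theorem BFormula.mk_le (V : L.Srt → Type u) (Γ : List L.Srt) :
    Cardinal.mk (BFormula L V Γ) ≤ max (Cardinal.mk (Σ s, V s)) L.size := by
  have h0 : Cardinal.aleph0 ≤ max (Cardinal.mk (Σ s, V s)) L.size :=
    L.aleph0_le_size.trans (le_max_right _ _)
  refine (Cardinal.mk_le_of_injective BFormula.tree_injective).trans
    ((mk_tree_le _).trans (max_le ?_ (le_max_right _ _)))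
  rw [Cardinal.mk_sum, Cardinal.lift_id, Cardinal.lift_id]
  exact Cardinal.add_le_of_le h0 (le_max_left _ _) (Cardinal.mk_le_aleph0.trans h0)

theorem Signature.mk_list_srt_le (L : Signature.{u}) : Cardinal.mk (List L.Srt) ≤ L.size :=
  (Cardinal.mk_list_le_max _).trans (max_le L.aleph0_le_size
    ((le_self_add.trans le_self_add).trans (le_max_right _ _)))

/-- The term `2 ^ L.size` pays for the last component, a set of formulas in finitely many variables.
The context and the formula cost at most the number of variables in `V` or `L.size`. -/
theorem Config.mk_le (V : L.Srt → Type u) :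
    Cardinal.mk (Config L V 1) ≤ max (Cardinal.mk (Σ s, V s)) (2 ^ L.size) := by
  set μ := max (Cardinal.mk (Σ s, V s)) (2 ^ L.size) with hμ
  have hT : L.size ≤ μ := (Cardinal.cantor _).le.trans (le_max_right _ _)
  have h0 : Cardinal.aleph0 ≤ μ := L.aleph0_le_size.trans hT
  have hform : ∀ Γ : List L.Srt, Cardinal.mk (Formula L (Join V (Var Γ))) ≤ μ := by
    intro Γ
    refine (BFormula.mk_le _ _).trans (max_le ?_ hT)
    have := Var.finite_sigma Γ
    rw [Cardinal.mk_congr (Equiv.sigmaSumDistrib V (Var Γ)), Cardinal.mk_sum, Cardinal.lift_id,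
      Cardinal.lift_id]
    exact Cardinal.add_le_of_le h0 (le_max_left _ _) (Cardinal.mk_le_aleph0.trans h0)
  have htype : ∀ Γ : List L.Srt, Cardinal.mk (Set (Formula L (Var Γ))) ≤ μ := by
    intro Γ
    rw [Cardinal.mk_set]
    refine (Cardinal.power_le_power_left two_ne_zero ?_).trans (le_max_right _ _)
    have := Var.finite_sigma Γ
    exact (BFormula.mk_le _ _).trans (max_le (Cardinal.mk_le_aleph0.trans L.aleph0_le_size) le_rfl)
  have hinj : Cardinal.mk (Config L V 1) ≤ Cardinal.mk
      (Σ Γ : List L.Srt, Formula L (Join V (Var Γ)) × Set (Formula L (Var Γ))) := by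
    refine Cardinal.mk_le_of_injective (f := fun c => ⟨c.ctx, c.form 0, c.type⟩) ?_
    rintro ⟨Γ, φ, t⟩ ⟨Γ', φ', t'⟩ h
    simp only [Sigma.mk.injEq] at h
    obtain ⟨rfl, h⟩ := h
    simp only [heq_eq_eq, Prod.mk.injEq] at h
    obtain ⟨h, rfl⟩ := h
    congr 1
    funext i
    rwa [Subsingleton.elim i 0]
  refine hinj.trans ?_
  rw [Cardinal.mk_sigma]
  refine (Cardinal.sum_le_mk_mul_iSup _).trans (Cardinal.mul_le_of_le h0
    (L.mk_list_srt_le.trans hT) (ciSup_le' fun Γ => ?_))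
  rw [Cardinal.mk_prod, Cardinal.lift_id, Cardinal.lift_id]
  exact Cardinal.mul_le_of_le h0 (hform Γ) (htype Γ)

end Counting

end ManySorted

open ManySorted in
theorem proposition4p5 (L : Signature.{u}) (C : L.Srt → Type u) [Struct L C] (κ : Cardinal.{u})
    (hC : IsMonster L C κ) (V : L.Srt → Type u) (X : Set (Formula L V)) :
    (∀ (n : ℕ) (q p : Fin n → TypesOn C X),
      content (fun i => (q i).1) ⊆ content (fun i => (p i).1) ↔
        ∃ η ∈ EL (Aut L C) (TypesOn C X), ∀ i, η (p i) = q i) ∧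
    Cardinal.mk {Y : Set (TypesOn C X) // IsSubflow (Aut L C) Y} ≤
      2 ^ (2 ^ (max (Cardinal.mk (Σ s, V s)) (2 ^ L.size)) : Cardinal.{u}) ∧
    (Cardinal.mk (Σ s, V s) < κ →
      Cardinal.mk {Y : Set (TypesOn C X) // IsSubflow (Aut L C) Y} < κ) := by
  have hκ : Cardinal.aleph0 ≤ κ := L.aleph0_le_size.trans hC.size_lt.le
  have hle : Cardinal.mk {Y : Set (TypesOn C X) // IsSubflow (Aut L C) Y} ≤
      2 ^ (2 ^ (max (Cardinal.mk (Σ s, V s)) (2 ^ L.size)) : Cardinal.{u}) :=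
    (mk_subflow_le hκ hC.homogeneous).trans (Cardinal.power_le_power_left two_ne_zero
      (Cardinal.power_le_power_left two_ne_zero (Config.mk_le V)))
  refine ⟨fun n q p => content_subset_iff hκ hC.homogeneous q p, hle, fun hV => hle.trans_lt ?_⟩
  -- Used three times: for the two outer exponentials and for `2 ^ L.size`.
  have h2 : ∀ {μ : Cardinal.{u}}, μ < κ → 2 ^ μ < κ := fun h => hC.strongLimit.isStrongPrelimit h
  exact h2 (h2 (max_lt hV (h2 hC.size_lt)))
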